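/- Assume the generalized Lindelöf hypothesis (GLH): for every $\varepsilon>0$ there is a constant $C_\varepsilon>0$ such that for every integer $q\ge 1$, every Dirichlet character $\chi$ modulo $q$, and every $s=\sigma+it$ with $\sigma\ge 1/2$ and $|s-1|\ge 1/2$, \[ |L(s,\chi)|\le C_\varepsilon\,(q(1+|t|))^{\varepsilon}. \] Then for every real $\eta\ge 1$ there exists $q_2(\eta)$ such that for all integers $q\ge q_2(\eta)$ the meromorphic function $\prod_{\chi\,(\mathrm{mod}\ q)}L(s,\chi)$ (the product over all Dirichlet characters modulo $q$) has at most one zero, counted with multiplicity, in the region \[ \sigma\ge 1-\frac{\eta}{\log q},\qquad |t|\le \log q . \] If such a zero $\rho$ exists, it is real and simple, and it is a zero of $L(s,\chi)$ for exactly one character $\chi$ modulo $q$; this $\chi$ is real and non-principal. -/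

import Mathlib

/-- The generalized Lindelöf hypothesis for Dirichlet `L`-functions: for every `ε > 0` one has
`L(σ + it, χ) ≪_ε (q (1 + |t|)) ^ ε`, uniformly over all moduli `q ≥ 1`, all Dirichlet characters
`χ` modulo `q`, and all `s = σ + it` with `σ ≥ 1/2` and `|s - 1| ≥ 1/2`. -/
def GeneralizedLindelof : Prop :=
  ∀ ε : ℝ, 0 < ε → ∃ C : ℝ, 0 < C ∧
    ∀ (q : ℕ) [NeZero q] (χ : DirichletCharacter ℂ q) (s : ℂ),
      1 / 2 ≤ s.re → 1 / 2 ≤ ‖s - 1‖ →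
        ‖DirichletCharacter.LFunction χ s‖ ≤ C * ((q : ℝ) * (1 + |s.im|)) ^ ε

/-- The function `s ↦ ∏_{χ mod q} L(s, χ)`, the product being over all Dirichlet characters
modulo `q`, the principal one included. It is meromorphic on `ℂ`. -/
noncomputable def prodLFunction (q : ℕ) [NeZero q] (s : ℂ) : ℂ :=
  ∏ χ : DirichletCharacter ℂ q, DirichletCharacter.LFunction χ s

/-- The region `σ ≥ 1 - η / log q`, `|t| ≤ log q`, where `s = σ + it`. -/
def nearOneRegion (η : ℝ) (q : ℕ) : Set ℂ :=
  {s | 1 - η / Real.log q ≤ s.re ∧ |s.im| ≤ Real.log q}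

/-- The zeros of `∏_{χ mod q} L(s, χ)`, i.e. the points where this meromorphic function has
positive order. (The order, unlike the value, is not affected by the value which is assigned to
`L(s, χ₀)` at its pole `s = 1`.) -/
def zerosProdLFunction (q : ℕ) [NeZero q] : Set ℂ :=
  {ρ | 0 < meromorphicOrderAt (prodLFunction q) ρ}

/-!
The proof is the classical argument of de la Vallée Poussin and Landau for zeros near `s = 1`, with
one change that comes from the Lindelöf hypothesis. Write `F(s, χ) = -Re (L'/L)(s, χ)`. In a disc
of fixed radius `1/2` centred at `c = 1 + a / log q + it` the hypothesis gives `|L(s, χ)| ≤ q ^ δ`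
for every `δ > 0` and all large `q`, and `|L(c, χ)| ≥ q ^ (-δ)` holds trivially; for the principal
character `χ₀` this is applied to `(s - 1) L(s, χ₀)`. Hence, after the
zeros have been removed by Blaschke factors and Borel–Carathéodory has been applied to the logarithm
of what remains (`neg_re_logDeriv_le`),
`F(c, χ) ≤ [χ = χ₀] Re 1/(c - 1) - ∑ Re 1/(c - ρ) + δ log q`,
where the sum may be restricted to any one or two zeros in the disc, because all the others
contribute with the favourable sign (`eventually_negReLogDerivL_le`). Unconditionally the error
would be `O(log q)`; since here `δ` is arbitrary, the classical inequalities can be used at distance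
`a / log q` from the line `σ = 1` with `a` as large as desired compared to `η`.

* With `a = 6 η`, the inequality `3 F(σ, χ₀) + 4 F(σ + iγ, χ) + F(σ + 2iγ, χ²) ≥ 0` shows that a
  zero in the region belongs to a character with `χ² = χ₀` and has `|γ| ≤ 100 η / log q`. For
  `χ = χ₀` such a zero would be a zero of `ζ` in a fixed small disc about its pole, which is
  impossible for large `q` (`eventually_zero_near_real_axis`).
* With `a = 1000 η`, two such zeros together outweigh the pole of `L(s, χ₀)`. So
  `F(σ, χ₀) + F(σ, χ) ≥ 0` excludes two zeros, or a double zero, of one character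
  (`eventually_not_two_zeros`), and
  `F(σ, χ₀) + F(σ, χ₁) + F(σ, χ₂) + F(σ, χ₁χ₂) ≥ 0` excludes zeros of two characters
  (`eventually_not_zero_of_two_characters`).

The remaining zero is real, since its complex conjugate is a zero of the same `L(s, χ)`.
-/

open Complex Filter Topology
open DirichletCharacter

/-! ### Functions without zeros in a disc, and division by zeros -/

/-- If `g` has no zero in a disc and `|g|` never exceeds `e ^ M |g c|` there, then
`|g' / g| ≤ 2 M / R` at the centre `c`: this is Borel–Carathéodory for a branch of `log g`. -/
lemma norm_logDeriv_le_of_ne_zero {g : ℂ → ℂ} {c : ℂ} {R M : ℝ} (hR : 0 < R) (hM : 0 < M)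
    (hg : DifferentiableOn ℂ g (Metric.ball c R)) (hg0 : ∀ z ∈ Metric.ball c R, g z ≠ 0)
    (hgM : ∀ z ∈ Metric.ball c R, ‖g z‖ ≤ Real.exp M * ‖g c‖) :
    ‖logDeriv g c‖ ≤ 2 * M / R := by
  have hcb : c ∈ Metric.ball c R := Metric.mem_ball_self hR
  have hLD : DifferentiableOn ℂ (logDeriv g) (Metric.ball c R) :=
    (hg.deriv Metric.isOpen_ball).div hg hg0
  obtain ⟨h, hhc, hh⟩ := (hLD.isExactOn_ball).with_val_at c 0
  have hhd : DifferentiableOn ℂ h (Metric.ball c R) :=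
    fun z hz => (hh z hz).differentiableAt.differentiableWithinAt
  have hexp : Set.EqOn (logDeriv g) (logDeriv fun z => Complex.exp (h z)) (Metric.ball c R) := by
    intro z hz
    have := (hh z hz).cexp.deriv
    rw [logDeriv_apply (fun z => Complex.exp (h z)), this, mul_comm,
      mul_div_cancel_right₀ _ (Complex.exp_ne_zero _)]
  obtain ⟨a, ha0, ha⟩ := (logDeriv_eqOn_iff hg hhd.cexp Metric.isOpen_ball
    (convex_ball c R).isPreconnected (fun z _ => Complex.exp_ne_zero _) hg0).1 hexp
  have hac : a = g c := by
    have := ha hcb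
    simp [hhc] at this
    exact this.symm
  have hre : ∀ z ∈ Metric.ball c R, (h z).re ≤ M := by
    intro z hz
    have h1 := hgM z hz
    rw [ha hz, Pi.smul_apply, smul_eq_mul, norm_mul, hac, mul_comm, Complex.norm_exp] at h1
    exact Real.exp_le_exp.1 (le_of_mul_le_mul_right h1 (norm_pos_iff.2 (hg0 c hcb)))
  set k : ℂ → ℂ := fun w => h (c + w) with hk
  have hmem : ∀ w ∈ Metric.ball (0 : ℂ) R, c + w ∈ Metric.ball c R := by
    intro w hw
    simpa [Metric.mem_ball, dist_eq_norm] using hw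
  have hkd : DifferentiableOn ℂ k (Metric.ball 0 R) := by
    refine hhd.comp (by fun_prop) hmem
  have hk0 : k 0 = 0 := by simp [hk, hhc]
  have hder : HasDerivAt k (logDeriv g c) 0 := by
    have := hh c hcb
    have h2 : HasDerivAt h (logDeriv g c) (c + 0) := by simpa using this
    simpa using h2.comp_const_add c 0
  have hbd : ∀ᶠ w in 𝓝[≠] (0 : ℂ), ‖slope k 0 w‖ ≤ 2 * M / (R - ‖w‖) := by
    filter_upwards [self_mem_nhdsWithin, mem_nhdsWithin_of_mem_nhds (Metric.ball_mem_nhds 0 hR)]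
      with w hw hwb
    have hw0 : 0 < ‖w‖ := norm_pos_iff.2 hw
    have hwR : 0 < R - ‖w‖ := by simpa using hwb
    have := borelCaratheodory_zero hM hkd (fun z hz => hre _ (hmem z hz)) hR hwb hk0
    rw [slope_def_module, hk0, sub_zero, sub_zero, norm_smul, norm_inv]
    rw [inv_mul_le_iff₀ hw0]
    exact this.trans (le_of_eq (by ring))
  have hlim : Tendsto (fun w : ℂ => 2 * M / (R - ‖w‖)) (𝓝[≠] 0) (𝓝 (2 * M / R)) := by
    refine tendsto_nhdsWithin_of_tendsto_nhds ?_
    have : ContinuousAt (fun w : ℂ => 2 * M / (R - ‖w‖)) 0 := by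
      refine ContinuousAt.div (by fun_prop) (by fun_prop) (by simpa using hR.ne')
    simpa [ContinuousAt] using this
  exact le_of_tendsto_of_tendsto (hasDerivAt_iff_tendsto_slope.1 hder).norm hlim hbd

/-- An entire function can be divided by `(z - c) ^ n` for every `n` up to its order at `c`. -/
lemma exists_eq_sub_pow_mul {f : ℂ → ℂ} (hf : Differentiable ℂ f) (c : ℂ) (n : ℕ)
    (hn : (n : ℕ∞) ≤ analyticOrderAt f c) :
    ∃ g : ℂ → ℂ, Differentiable ℂ g ∧ ∀ z, f z = (z - c) ^ n * g z := by
  induction n generalizing f with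
  | zero => exact ⟨f, hf, by simp⟩
  | succ n ih =>
    have hfc : f c = 0 := by
      refine apply_eq_zero_of_analyticOrderAt_ne_zero ?_
      intro h
      rw [h] at hn
      simp at hn
    have hd : Differentiable ℂ (dslope f c) := by
      rw [← differentiableOn_univ, differentiableOn_dslope univ_mem]
      exact hf.differentiableOn
    have heq : ∀ z, f z = (z - c) * dslope f c z := by
      intro z
      have := sub_smul_dslope f c z
      rw [hfc, sub_zero] at this
      exact this.symm
    have hord : analyticOrderAt f c = 1 + analyticOrderAt (dslope f c) c := by
      have h1 : f = (fun z => z - c) * dslope f c := funext heq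
      have h2 : analyticOrderAt (fun z => z - c) c = 1 := by
        have ha : AnalyticAt ℂ (fun z => z - c) c := by fun_prop
        refine (ha.analyticOrderAt_eq_natCast (n := 1)).2 ?_
        exact ⟨fun _ => 1, analyticAt_const, one_ne_zero, by simp⟩
      conv_lhs => rw [h1]
      rw [analyticOrderAt_mul (by fun_prop) (hd.analyticAt c), h2]
    have hn' : (n : ℕ∞) ≤ analyticOrderAt (dslope f c) c := by
      rw [hord] at hn
      push_cast at hn
      rw [add_comm] at hn
      exact (ENat.add_le_add_iff_left (by simp)).1 hn
    obtain ⟨g, hg, hfg⟩ := ih hd hn'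
    exact ⟨g, hg, fun z => by rw [heq z, hfg z]; ring⟩

/-- The zeros of an entire function in a finite set can be factored out, with their
multiplicities, by an entire cofactor that has no new zeros. -/
lemma exists_eq_list_prod_mul {f : ℂ → ℂ} (hf : Differentiable ℂ f) {c : ℂ} (hc : f c ≠ 0)
    (S : Finset ℂ) :
    ∃ (l : List ℂ) (g : ℂ → ℂ), (∀ ρ ∈ l, f ρ = 0 ∧ ρ ∈ S) ∧ Differentiable ℂ g ∧
      (∀ z, f z = (l.map (fun ρ => z - ρ)).prod * g z) ∧ (∀ z ∈ S, g z ≠ 0) := by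
  classical
  induction S using Finset.induction_on with
  | empty => exact ⟨[], f, by simp, hf, by simp, by simp⟩
  | insert a S ha ih =>
    obtain ⟨l, g, hl, hg, hfg, hgS⟩ := ih
    have hgc : g c ≠ 0 := fun h => hc (by rw [hfg c, h, mul_zero])
    have hne : analyticOrderAt g a ≠ ⊤ := by
      intro h
      rw [analyticOrderAt_eq_top] at h
      have hga := hg.differentiableOn.analyticOnNhd isOpen_univ
      exact hgc (hga.eqOn_zero_of_preconnected_of_eventuallyEq_zero isPreconnected_univ
        (Set.mem_univ a) h (Set.mem_univ c))
    obtain ⟨n, hn⟩ := ENat.ne_top_iff_exists.1 hne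
    obtain ⟨h, hh, hgh⟩ := exists_eq_sub_pow_mul hg a n hn.le
    have hha : h a ≠ 0 := by
      obtain ⟨k, hk, hka, hgk⟩ := ((hg.analyticAt a).analyticOrderAt_eq_natCast (n := n)).1 hn.symm
      have h1 : ∀ᶠ z in 𝓝[≠] a, h z = k z := by
        filter_upwards [self_mem_nhdsWithin, mem_nhdsWithin_of_mem_nhds hgk] with z hz hz2
        rw [hgh z, smul_eq_mul] at hz2
        exact mul_left_cancel₀ (pow_ne_zero _ (sub_ne_zero.2 hz)) hz2
      have h2 : h a = k a := tendsto_nhds_unique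
        (tendsto_nhdsWithin_of_tendsto_nhds (hh a).continuousAt.tendsto)
        ((tendsto_congr' h1).2 (tendsto_nhdsWithin_of_tendsto_nhds hk.continuousAt.tendsto))
      rwa [h2]
    refine ⟨List.replicate n a ++ l, h, ?_, hh, ?_, ?_⟩
    · intro ρ hρ
      rcases List.mem_append.1 hρ with h1 | h1
      · obtain ⟨hn0, rfl⟩ := List.mem_replicate.1 h1
        refine ⟨?_, Finset.mem_insert_self _ _⟩
        rw [hfg, hgh]
        simp [hn0]
      · exact ⟨(hl ρ h1).1, Finset.mem_insert_of_mem (hl ρ h1).2⟩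
    · intro z
      rw [hfg z, hgh z]
      simp
      ring
    · intro z hz
      rcases Finset.mem_insert.1 hz with rfl | h1
      · exact hha
      · intro h0
        exact hgS z h1 (by rw [hgh z, h0, mul_zero])

/-! ### The logarithmic derivative at the centre of a disc -/

/-- Bound for the logarithmic derivative at the centre of a disc in terms of all the zeros in that
disc. The zeros are removed one at a time by Blaschke factors: such a factor does not change `|f|`
on the circle and can only increase `|f|` at the centre. -/
lemma neg_re_logDeriv_le_of_list {c : ℂ} {R M : ℝ} (hR : 0 < R) (hM : 0 < M) (l : List ℂ) :
    ∀ {f g : ℂ → ℂ}, Differentiable ℂ g → (∀ z, f z = (l.map (fun ρ => z - ρ)).prod * g z) →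
      (∀ z ∈ Metric.ball c R, g z ≠ 0) → (∀ ρ ∈ l, ρ ∈ Metric.ball c R) → f c ≠ 0 →
      (∀ z ∈ Metric.closedBall c R, ‖f z‖ ≤ Real.exp M * ‖f c‖) →
      -(logDeriv f c).re ≤
        (l.map (fun ρ => (c - ρ).re / R ^ 2 - (1 / (c - ρ)).re)).sum + 2 * M / R := by
  induction l with
  | nil =>
    intro f g hg hfg hg0 _ _ hfM
    obtain rfl : f = g := by ext z; simpa using hfg z
    have h1 := norm_logDeriv_le_of_ne_zero hR hM hg.differentiableOn hg0
      (fun z hz => hfM z (Metric.ball_subset_closedBall hz))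
    have h2 := Complex.abs_re_le_norm (logDeriv f c)
    have h3 := neg_le_abs (logDeriv f c).re
    simp only [List.map_nil, List.sum_nil, zero_add]
    linarith
  | cons ρ l ih =>
    intro f g hg hfg hg0 hl hfc hfM
    have hRC : (R : ℂ) ≠ 0 := by exact_mod_cast hR.ne'
    set F : ℂ → ℂ := fun z => (l.map (fun ρ => z - ρ)).prod * g z with hF
    set b : ℂ → ℂ := fun z => ((R : ℂ) ^ 2 - (starRingEnd ℂ) (ρ - c) * (z - c)) / R with hb
    have hprod : Differentiable ℂ fun z : ℂ => (l.map (fun ρ => z - ρ)).prod := by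
      clear_value F b
      clear hl hfg ih hF
      induction l with
      | nil => simp
      | cons a l ih => simpa using! (by fun_prop : Differentiable ℂ fun z : ℂ => z - a).mul ih
    have hFd : Differentiable ℂ F := hprod.mul hg
    have hbd : Differentiable ℂ b := by rw [hb]; fun_prop
    have hfF : ∀ z, f z = (z - ρ) * F z := fun z => by
      rw [hfg z, List.map_cons, List.prod_cons, mul_assoc]
    have hw : ‖ρ - c‖ < R := by simpa [dist_eq_norm] using hl ρ (by simp)
    have hcρ : c - ρ ≠ 0 := fun h => hfc (by rw [hfF, h, zero_mul])
    have hFc : F c ≠ 0 := fun h => hfc (by rw [hfF, h, mul_zero])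
    have hbc : b c = R := by simp [hb]; field_simp
    have hsphere : ∀ z, ‖z - c‖ = R → ‖b z‖ = ‖z - ρ‖ := by
      intro z hz
      have h1 : (R : ℂ) ^ 2 = (starRingEnd ℂ) (z - c) * (z - c) := by
        rw [← Complex.normSq_eq_conj_mul_self, Complex.normSq_eq_norm_sq, hz]
        push_cast; rfl
      have h2 : b z = (starRingEnd ℂ) (z - ρ) * (z - c) / R := by
        rw [hb]; simp only; rw [h1, ← sub_mul, ← map_sub]; congr 3; ring
      rw [h2, norm_div, norm_mul, RCLike.norm_conj, hz, Complex.norm_real, Real.norm_eq_abs,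
        abs_of_pos hR, mul_div_cancel_right₀ _ hR.ne']
    have hb0 : ∀ z ∈ Metric.ball c R, b z ≠ 0 := by
      intro z hz h0
      have hz' : ‖z - c‖ < R := by simpa [dist_eq_norm] using hz
      rw [hb] at h0
      simp only [div_eq_zero_iff, hRC, or_false, sub_eq_zero] at h0
      have h1 := congrArg norm h0
      rw [norm_mul, RCLike.norm_conj, norm_pow, Complex.norm_real, Real.norm_eq_abs,
        abs_of_pos hR] at h1
      nlinarith [norm_nonneg (ρ - c), norm_nonneg (z - c)]
    have hcle : ‖f c‖ ≤ ‖F c * b c‖ := by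
      rw [hfF c, norm_mul (c - ρ), norm_mul (F c), hbc, Complex.norm_real, Real.norm_eq_abs,
        abs_of_pos hR, mul_comm, norm_sub_rev]
      gcongr
    have hmax : ∀ z ∈ Metric.closedBall c R, ‖F z * b z‖ ≤ Real.exp M * ‖F c * b c‖ := by
      intro z hz
      rw [← closure_ball c hR.ne'] at hz
      refine Complex.norm_le_of_forall_mem_frontier_norm_le (f := fun z => F z * b z)
        Metric.isBounded_ball (hFd.mul hbd).diffContOnCl ?_ hz
      intro w hw
      rw [frontier_ball c hR.ne', mem_sphere_iff_norm] at hw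
      have h1 : ‖F w * b w‖ = ‖f w‖ := by
        rw [norm_mul (F w), hsphere w hw, hfF w, norm_mul (w - ρ), mul_comm]
      rw [h1]
      refine (hfM w (by simp [dist_eq_norm, hw])).trans ?_
      gcongr
    have key := ih (f := fun z => F z * b z) (g := fun z => g z * b z) (hg.mul hbd)
      (fun z => by simp only [hF]; ring) (fun z hz => mul_ne_zero (hg0 z hz) (hb0 z hz))
      (fun σ hσ => hl σ (List.mem_cons_of_mem _ hσ))
      (mul_ne_zero hFc (by rw [hbc]; exact hRC)) hmax
    have hd1 : logDeriv f c = 1 / (c - ρ) + logDeriv F c := by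
      have : f = fun z => (z - ρ) * F z := funext hfF
      rw [this, logDeriv_mul (f := fun z => z - ρ) c hcρ hFc (by fun_prop) (hFd c), logDeriv_apply]
      simp
    have hd2 : logDeriv (fun z => F z * b z) c
        = logDeriv F c + (starRingEnd ℂ) (c - ρ) / (R : ℂ) ^ 2 := by
      rw [logDeriv_mul c hFc (by rw [hbc]; exact hRC) (hFd c) (hbd c), logDeriv_apply b, hbc]
      have : deriv b c = (starRingEnd ℂ) (c - ρ) / R := by
        have h1 : HasDerivAt b ((0 - (starRingEnd ℂ) (ρ - c) * 1) / R) c :=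
          (((hasDerivAt_id c).sub_const c).const_mul _ |>.const_sub _ |>.div_const _).congr_deriv
            (by simp)
        rw [h1.deriv]
        simp
      rw [this]
      field_simp
    rw [hd2] at key
    rw [hd1, List.map_cons, List.sum_cons]
    have h3 : ((starRingEnd ℂ) (c - ρ) / (R : ℂ) ^ 2).re = (c - ρ).re / R ^ 2 := by
      rw [← Complex.ofReal_pow, Complex.div_ofReal_re, Complex.conj_re]
    rw [Complex.add_re, h3] at key
    rw [Complex.add_re]
    linarith

/-- Upper bound for `-Re f'/f` at the centre `c` of a disc whose zeros of `f` all lie to the left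
of `c`. Only the zeros in the list `l` have to be known: every other zero of the disc would make
the left side smaller. -/
lemma neg_re_logDeriv_le {f h : ℂ → ℂ} {c : ℂ} {R M : ℝ} (hR : 0 < R) (hM : 0 < M) (l : List ℂ)
    (hh : Differentiable ℂ h) (hfh : ∀ z, f z = (l.map (fun ρ => z - ρ)).prod * h z)
    (hl : ∀ ρ ∈ l, ρ ∈ Metric.ball c R) (hfc : f c ≠ 0)
    (hzero : ∀ z, f z = 0 → z.re ≤ c.re)
    (hfM : ∀ z ∈ Metric.closedBall c R, ‖f z‖ ≤ Real.exp M * ‖f c‖) :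
    -(logDeriv f c).re ≤
      (l.map (fun ρ => (c - ρ).re / R ^ 2 - (1 / (c - ρ)).re)).sum + 2 * M / R := by
  have hhc : h c ≠ 0 := fun h0 => hfc (by rw [hfh, h0, mul_zero])
  have hfin : {z | z ∈ Metric.closedBall c R ∧ h z = 0}.Finite := by
    by_contra hinf
    obtain ⟨x, hxK, hx⟩ := 
      Set.Infinite.exists_accPt_of_subset_isCompact hinf (isCompact_closedBall c R)
        (fun z hz => hz.1)
    have hfr : ∃ᶠ z in 𝓝[≠] x, h z = 0 :=
      (accPt_iff_frequently_nhdsNE.1 hx).mono fun z hz => hz.2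
    exact hhc ((hh.differentiableOn.analyticOnNhd
      isOpen_univ).eqOn_zero_of_preconnected_of_frequently_eq_zero
        isPreconnected_univ (Set.mem_univ x) hfr (Set.mem_univ c))
  classical
  obtain ⟨l', g, hl', hg, hhg, hgS⟩ := exists_eq_list_prod_mul hh hhc
    (hfin.toFinset.filter (· ∈ Metric.ball c R))
  have hlb : ∀ ρ ∈ l', ρ ∈ Metric.ball c R := fun ρ hρ => (Finset.mem_filter.1 (hl' ρ hρ).2).2
  have key := neg_re_logDeriv_le_of_list hR hM (l ++ l') (f := f) (g := g) hg
    (fun z => by rw [hfh z, hhg z]; simp [mul_assoc]) ?_ ?_ hfc hfM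
  · rw [List.map_append, List.sum_append] at key
    have hneg : (l'.map (fun ρ => (c - ρ).re / R ^ 2 - (1 / (c - ρ)).re)).sum ≤ 0 := by
      refine (List.sum_le_card_nsmul _ 0 ?_).trans_eq (smul_zero _)
      intro x hx
      obtain ⟨ρ, hρ, rfl⟩ := List.mem_map.1 hx
      have h1 : ρ.re ≤ c.re := hzero ρ (by rw [hfh, (hl' ρ hρ).1, mul_zero])
      have h2 : ‖c - ρ‖ < R := by
        have := hlb ρ hρ
        rwa [Metric.mem_ball, dist_comm, dist_eq_norm] at this
      have h3 : c - ρ ≠ 0 := fun h0 => hhc (by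
        rw [sub_eq_zero.1 h0]; exact (hl' ρ hρ).1)
      have h4 : 0 < ‖c - ρ‖ := norm_pos_iff.2 h3
      rw [one_div, Complex.inv_re, Complex.normSq_eq_norm_sq, sub_nonpos]
      have h5 : 0 ≤ (c - ρ).re := by simpa using h1
      gcongr
    linarith
  · intro z hz h0
    refine hgS z ?_ h0
    simp only [Finset.mem_filter, Set.Finite.mem_toFinset, Set.mem_ofPred_eq]
    exact ⟨⟨Metric.ball_subset_closedBall hz, by rw [hhg, h0, mul_zero]⟩, hz⟩
  · intro ρ hρ
    rcases List.mem_append.1 hρ with h1 | h1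
    · exact hl ρ h1
    · exact hlb ρ h1

/-! ### Dirichlet series for `-L'/L` and positivity -/

section Positivity

/-- The term of the Dirichlet series of `-L'/L` at `σ + it`, with the size `Λ(n) n^{-σ}`
separated from the phase `χ(n) n^{-it}`. -/
lemma term_twist_vonMangoldt_add_mul_I {q : ℕ} (χ : DirichletCharacter ℂ q) (σ t : ℝ) {n : ℕ}
    (hn : n ≠ 0) :
    LSeries.term ((fun n : ℕ => χ n) * fun n : ℕ => (ArithmeticFunction.vonMangoldt n : ℂ))
      (σ + t * I) n
      = ((ArithmeticFunction.vonMangoldt n / (n : ℝ) ^ σ : ℝ) : ℂ)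
        * (χ n * (n : ℂ) ^ (-(t * I))) := by
  have hn' : (n : ℂ) ≠ 0 := by exact_mod_cast hn
  rw [LSeries.term_of_ne_zero hn, Pi.mul_apply, Complex.cpow_add _ _ hn', Complex.cpow_neg,
    Complex.ofReal_div, Complex.ofReal_cpow (Nat.cast_nonneg n)]
  simp only [Complex.ofReal_natCast]
  field_simp

variable {q : ℕ} [NeZero q]

/-- `-Re (L'/L)(s, χ)`. -/
noncomputable def negReLogDerivL (χ : DirichletCharacter ℂ q) (s : ℂ) : ℝ :=
  -(logDeriv (LFunction χ) s).re

lemma hasSum_negReLogDerivL (χ : DirichletCharacter ℂ q) {s : ℂ} (hs : 1 < s.re) :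
    HasSum (fun n : ℕ => (LSeries.term ((fun n : ℕ => χ n) *
      fun n : ℕ => (ArithmeticFunction.vonMangoldt n : ℂ)) s n).re) (negReLogDerivL χ s) := by
  have h1 := (LSeriesSummable_twist_vonMangoldt χ hs).hasSum
  have h2 := Complex.hasSum_re h1
  convert h2 using 1
  have h3 := LSeries_twist_vonMangoldt_eq χ hs
  rw [LSeries] at h3
  rw [h3, negReLogDerivL, logDeriv_apply, deriv_LFunction_eq_deriv_LSeries χ hs,
    LFunction_eq_LSeries χ hs, neg_div, Complex.neg_re]

lemma vonMangoldt_div_rpow_nonneg (σ : ℝ) (n : ℕ) :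
    0 ≤ ArithmeticFunction.vonMangoldt n / (n : ℝ) ^ σ :=
  div_nonneg ArithmeticFunction.vonMangoldt_nonneg (by positivity)

/-- The inequality `3 + 4 cos θ + cos 2θ ≥ 0`, summed over prime powers. -/
lemma three_four_one_negReLogDerivL (χ : DirichletCharacter ℂ q) {σ : ℝ} (hσ : 1 < σ) (t : ℝ) :
    0 ≤ 3 * negReLogDerivL (1 : DirichletCharacter ℂ q) σ + 4 * negReLogDerivL χ (σ + t * I)
      + negReLogDerivL (χ ^ 2) (σ + (2 * t : ℝ) * I) := by
  have h0 := hasSum_negReLogDerivL (1 : DirichletCharacter ℂ q) (s := (σ : ℂ) + (0 : ℝ) * I)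
    (by simpa using hσ)
  have h1 := hasSum_negReLogDerivL χ (s := (σ : ℂ) + t * I) (by simpa using hσ)
  have h2 := hasSum_negReLogDerivL (χ ^ 2) (s := (σ : ℂ) + (2 * t : ℝ) * I) (by simpa using hσ)
  have h3 := ((h0.mul_left 3).add (h1.mul_left 4)).add h2
  rw [show ((σ : ℂ) + (0 : ℝ) * I) = σ by simp] at h3
  refine h3.nonneg fun n => ?_
  rcases eq_or_ne n 0 with rfl | hn
  · simp
  rw [show (σ : ℂ) = σ + (0 : ℝ) * I by simp, term_twist_vonMangoldt_add_mul_I _ _ _ hn,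
    show (σ + (0 : ℝ) * I : ℂ) = σ by simp, term_twist_vonMangoldt_add_mul_I _ _ _ hn,
    term_twist_vonMangoldt_add_mul_I _ _ _ hn]
  have hA := vonMangoldt_div_rpow_nonneg σ n
  set A := ArithmeticFunction.vonMangoldt n / (n : ℝ) ^ σ
  rw [Complex.re_ofReal_mul, Complex.re_ofReal_mul, Complex.re_ofReal_mul]
  by_cases hu : IsUnit (n : ZMod q)
  · set w : ℂ := χ n * (n : ℂ) ^ (-(t * I)) with hw
    have hw1 : ‖w‖ = 1 := by
      obtain ⟨u, hu'⟩ := hu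
      rw [hw, norm_mul, ← hu', unit_norm_eq_one, one_mul,
        Complex.norm_natCast_cpow_of_pos (Nat.pos_of_ne_zero hn)]
      simp
    have hw2 : (χ ^ 2) n * (n : ℂ) ^ (-(((2 * t : ℝ) : ℂ) * I)) = w ^ 2 := by
      rw [hw, mul_pow, MulChar.pow_apply' _ two_ne_zero, ← Complex.cpow_nat_mul]
      congr 2
      push_cast; ring
    have hsq : w.re ^ 2 + w.im ^ 2 = 1 := by
      have := Complex.sq_norm w
      rw [hw1, Complex.normSq_apply] at this
      linarith
    rw [hw2, MulChar.one_apply hu]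
    have h4 : (w ^ 2).re = w.re ^ 2 - w.im ^ 2 := by rw [sq, Complex.mul_re]; ring
    rw [h4]
    simp only [ofReal_zero, zero_mul, neg_zero, cpow_zero, mul_one, one_re]
    nlinarith [mul_nonneg hA (sq_nonneg (1 + w.re))]
  · simp [MulChar.map_nonunit _ hu]

/-- Characters with `χ² = 1` take only the values `0, 1, -1`, so `(1 + χ₁(n)) (1 + χ₂(n)) ≥ 0`. -/
lemma negReLogDerivL_add_of_sq_eq_one {χ₁ χ₂ : DirichletCharacter ℂ q} (h₁ : χ₁ ^ 2 = 1)
    (h₂ : χ₂ ^ 2 = 1) {σ : ℝ} (hσ : 1 < σ) :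
    0 ≤ negReLogDerivL (1 : DirichletCharacter ℂ q) σ + negReLogDerivL χ₁ σ
      + negReLogDerivL χ₂ σ + negReLogDerivL (χ₁ * χ₂) σ := by
  have h (χ : DirichletCharacter ℂ q) := hasSum_negReLogDerivL χ (s := (σ : ℂ)) (by simpa using hσ)
  refine (((h 1).add (h χ₁)).add (h χ₂)).add (h (χ₁ * χ₂)) |>.nonneg fun n => ?_
  rcases eq_or_ne n 0 with rfl | hn
  · simp
  have hterm (χ : DirichletCharacter ℂ q) := term_twist_vonMangoldt_add_mul_I χ σ 0 hn
  simp only [ofReal_zero, zero_mul, add_zero, neg_zero, cpow_zero, mul_one] at hterm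
  simp only [hterm]
  have hA := vonMangoldt_div_rpow_nonneg σ n
  set A := ArithmeticFunction.vonMangoldt n / (n : ℝ) ^ σ
  simp only [Complex.re_ofReal_mul]
  by_cases hu : IsUnit (n : ZMod q)
  · have hval : ∀ χ : DirichletCharacter ℂ q, χ ^ 2 = 1 → χ n = 1 ∨ χ n = -1 := by
      intro χ hχ
      have := congrArg (fun ψ : DirichletCharacter ℂ q => ψ n) hχ
      simp only [MulChar.pow_apply' _ two_ne_zero, MulChar.one_apply hu] at this
      exact mul_self_eq_one_iff.1 ((sq _).symm.trans this)
    rw [MulChar.one_apply hu, MulChar.mul_apply]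
    rcases hval χ₁ h₁ with h1 | h1 <;> rcases hval χ₂ h₂ with h2 | h2 <;> simp [h1, h2]
    linarith
  · simp [MulChar.map_nonunit _ hu]

lemma negReLogDerivL_one_add_nonneg (χ : DirichletCharacter ℂ q) {σ : ℝ} (hσ : 1 < σ) :
    0 ≤ negReLogDerivL (1 : DirichletCharacter ℂ q) σ + negReLogDerivL χ σ := by
  have h (χ : DirichletCharacter ℂ q) := hasSum_negReLogDerivL χ (s := (σ : ℂ)) (by simpa using hσ)
  refine (h 1).add (h χ) |>.nonneg fun n => ?_
  rcases eq_or_ne n 0 with rfl | hn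
  · simp
  have hterm (χ : DirichletCharacter ℂ q) := term_twist_vonMangoldt_add_mul_I χ σ 0 hn
  simp only [ofReal_zero, zero_mul, add_zero, neg_zero, cpow_zero, mul_one] at hterm
  simp only [hterm]
  have hA := vonMangoldt_div_rpow_nonneg σ n
  set A := ArithmeticFunction.vonMangoldt n / (n : ℝ) ^ σ
  simp only [Complex.re_ofReal_mul]
  by_cases hu : IsUnit (n : ZMod q)
  · have h1 : -1 ≤ (χ n).re := by
      have := (Complex.abs_re_le_norm (χ n)).trans (χ.norm_le_one n)
      linarith [neg_abs_le (χ n).re]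
    rw [MulChar.one_apply hu, one_re]
    nlinarith
  · simp [MulChar.map_nonunit _ hu]

/-- `|L(s, χ)| ≥ (σ - 1) / σ` for `σ > 1`, because `|1 / L(s, χ)| ≤ ζ(σ) ≤ σ / (σ - 1)`. -/
lemma le_norm_LFunction (χ : DirichletCharacter ℂ q) {s : ℂ} (hs : 1 < s.re) :
    (s.re - 1) / s.re ≤ ‖LFunction χ s‖ := by
  have hmul := LSeries.mul_mu_eq_one χ hs
  rw [← LFunction_eq_LSeries χ hs] at hmul
  have hsumm : Summable fun n : ℕ => 1 / (n : ℝ) ^ s.re := Real.summable_one_div_nat_rpow.2 hs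
  have hle : ‖LSeries ((fun n : ℕ => χ n) * fun n : ℕ => (ArithmeticFunction.moebius n : ℂ)) s‖
      ≤ ∑' n : ℕ, 1 / (n : ℝ) ^ s.re := by
    refine tsum_of_norm_bounded hsumm.hasSum fun n => ?_
    rw [LSeries.norm_term_eq]
    split_ifs with hn
    · positivity
    · gcongr
      rw [Pi.mul_apply, norm_mul]
      refine mul_le_one₀ (χ.norm_le_one _) (norm_nonneg _) ?_
      rw [Complex.norm_intCast]
      exact_mod_cast ArithmeticFunction.abs_moebius_le_one
  have hz : ∑' n : ℕ, 1 / (n : ℝ) ^ s.re ≤ s.re / (s.re - 1) := by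
    rw [hsumm.tsum_eq_zero_add]
    have h1 := ZetaAsymptotics.zeta_limit_aux1 hs
    have h2 : 0 ≤ ZetaAsymptotics.termTSum s.re := by
      rw [ZetaAsymptotics.termTSum]
      exact tsum_nonneg fun n => ZetaAsymptotics.term_nonneg _ _
    have h3 : s.re / (s.re - 1) = 1 + 1 / (s.re - 1) := by
      field_simp [(sub_pos.2 hs).ne']
      ring
    have h4 : (1 : ℝ) / ((0 : ℕ) : ℝ) ^ s.re = 0 := by
      rw [Nat.cast_zero, Real.zero_rpow (by linarith), div_zero]
    rw [h3, h4]
    push_cast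
    nlinarith
  have hpos : 0 < s.re - 1 := sub_pos.2 hs
  have h5 : 1 ≤ ‖LFunction χ s‖ * (s.re / (s.re - 1)) := by
    have := congrArg norm hmul
    rw [norm_mul, norm_one] at this
    exact this.symm.le.trans (mul_le_mul_of_nonneg_left (hle.trans hz) (norm_nonneg _))
  rw [div_le_iff₀ (by linarith)]
  calc s.re - 1 = 1 * (s.re - 1) := by ring
    _ ≤ ‖LFunction χ s‖ * (s.re / (s.re - 1)) * (s.re - 1) := by gcongr
    _ = _ := by field_simp

end Positivity

/-! ### The entire functions `(s - 1) L(s, χ₀)` and `L(s, χ)` -/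

section Entire

variable {q : ℕ} [NeZero q]

open Classical in
/-- The entire function `(s - 1) L(s, χ₀)` for the principal character `χ₀`, and `L(s, χ)` itself
for every other character. -/
noncomputable def entireL (χ : DirichletCharacter ℂ q) : ℂ → ℂ :=
  if χ = 1 then LFunctionTrivChar₁ q else LFunction χ

lemma entireL_of_ne_one {χ : DirichletCharacter ℂ q} (hχ : χ ≠ 1) : entireL χ = LFunction χ :=
  if_neg hχ

lemma entireL_one : entireL (1 : DirichletCharacter ℂ q) = LFunctionTrivChar₁ q := if_pos rfl

lemma entireL_one_apply {s : ℂ} (hs : s ≠ 1) :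
    entireL (1 : DirichletCharacter ℂ q) s = (s - 1) * LFunction (1 : DirichletCharacter ℂ q) s := by
  rw [entireL_one]; exact Function.update_of_ne hs ..

lemma differentiable_entireL (χ : DirichletCharacter ℂ q) : Differentiable ℂ (entireL χ) := by
  by_cases hχ : χ = 1
  · subst hχ; rw [entireL_one]; exact differentiable_LFunctionTrivChar₁ q
  · rw [entireL_of_ne_one hχ]; exact differentiable_LFunction hχ

lemma entireL_ne_zero_of_one_le_re (χ : DirichletCharacter ℂ q) {s : ℂ} (hs : 1 ≤ s.re) :
    entireL χ s ≠ 0 := by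
  by_cases hχ : χ = 1
  · subst hχ
    rcases eq_or_ne s 1 with rfl | h1
    · rw [entireL_one]; exact LFunctionTrivChar₁_apply_one_ne_zero q
    · rw [entireL_one_apply h1]
      exact mul_ne_zero (sub_ne_zero.2 h1) (LFunction_ne_zero_of_one_le_re 1 (.inr h1) hs)
  · rw [entireL_of_ne_one hχ]; exact LFunction_ne_zero_of_one_le_re χ (.inl hχ) hs

open Classical in
lemma negReLogDerivL_eq (χ : DirichletCharacter ℂ q) {s : ℂ} (hs : 1 < s.re) :
    negReLogDerivL χ s =
      -(logDeriv (entireL χ) s).re + if χ = 1 then (1 / (s - 1)).re else 0 := by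
  by_cases hχ : χ = 1
  · subst hχ
    have hs1 : s ≠ 1 := by rintro rfl; simp at hs
    have hev : entireL (1 : DirichletCharacter ℂ q) =ᶠ[𝓝 s]
        fun z => (z - 1) * LFunction (1 : DirichletCharacter ℂ q) z := by
      filter_upwards [isOpen_ne.mem_nhds hs1] with z hz using entireL_one_apply hz
    rw [(logDeriv_congr_nhds hev).eq_of_nhds, logDeriv_mul (f := fun z => z - 1) s (sub_ne_zero.2 hs1)
      (LFunction_ne_zero_of_one_le_re 1 (.inr hs1) hs.le) (by fun_prop)
      (differentiableAt_LFunction _ _ (.inl hs1)), logDeriv_apply (fun z => z - 1)]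
    simp [negReLogDerivL]
  · simp [hχ, entireL_of_ne_one, negReLogDerivL]

end Entire

/-! ### Bounds under the Lindelöf hypothesis -/

lemma tendsto_log_natCast_atTop : Tendsto (fun q : ℕ => Real.log q) atTop atTop :=
  Real.tendsto_log_atTop.comp tendsto_natCast_atTop_atTop

/-- On a bounded piece of the strip `1/2 ≤ σ ≤ 2` a Lindelöf bound for `L(s, χ)` carries over to
the entire function `entireL χ`; the disc `|s - 1| < 1/2` is covered by the maximum principle. -/
lemma norm_entireL_le_of_bound {q : ℕ} [NeZero q] (χ : DirichletCharacter ℂ q) {C ε T : ℝ}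
    (hC : 0 < C) (hε : 0 < ε) (hT : 1 / 2 ≤ T)
    (hL : ∀ s : ℂ, 1 / 2 ≤ s.re → 1 / 2 ≤ ‖s - 1‖ →
      ‖LFunction χ s‖ ≤ C * ((q : ℝ) * (1 + |s.im|)) ^ ε)
    {z : ℂ} (hz : 1 / 2 ≤ z.re) (hz2 : z.re ≤ 2) (hzT : |z.im| ≤ T) :
    ‖entireL χ z‖ ≤ (2 + T) * (C * ((q : ℝ) * (1 + T)) ^ ε) := by
  have hfar : ∀ s : ℂ, 1 / 2 ≤ s.re → s.re ≤ 2 → |s.im| ≤ T → 1 / 2 ≤ ‖s - 1‖ →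
      ‖entireL χ s‖ ≤ (2 + T) * (C * ((q : ℝ) * (1 + T)) ^ ε) := by
    intro s h1 h2 h3 h4
    have hb : ‖LFunction χ s‖ ≤ C * ((q : ℝ) * (1 + T)) ^ ε := by
      refine (hL s h1 h4).trans ?_
      gcongr
    by_cases hχ : χ = 1
    · subst hχ
      have hs1 : s ≠ 1 := by rintro rfl; norm_num at h4
      rw [entireL_one_apply hs1, norm_mul]
      have hn : ‖s - 1‖ ≤ 2 + T := by
        refine (Complex.norm_le_abs_re_add_abs_im _).trans ?_
        simp only [sub_re, one_re, sub_im, one_im, sub_zero]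
        have : |s.re - 1| ≤ 1 := abs_le.2 ⟨by linarith, by linarith⟩
        linarith
      gcongr
    · rw [entireL_of_ne_one hχ]
      refine hb.trans (le_mul_of_one_le_left (by positivity) (by linarith))
  rcases le_or_gt (1 / 2) ‖z - 1‖ with h | h
  · exact hfar z hz hz2 hzT h
  · refine Complex.norm_le_of_forall_mem_frontier_norm_le (U := Metric.ball (1 : ℂ) (1 / 2))
      Metric.isBounded_ball (differentiable_entireL χ).diffContOnCl ?_
      (subset_closure (by simpa [dist_eq_norm] using h))
    intro w hw
    rw [frontier_ball _ (by norm_num), mem_sphere_iff_norm] at hw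
    have h1 := (Complex.abs_re_le_norm (w - 1)).trans hw.le
    have h2 := (Complex.abs_im_le_norm (w - 1)).trans hw.le
    simp only [sub_re, one_re, sub_im, one_im, sub_zero] at h1 h2
    have h3 := abs_le.1 h1
    exact hfar w (by linarith) (by linarith) (h2.trans hT) hw.ge

lemma eventually_mul_pow_le_exp (k : ℕ) (A : ℝ) {δ : ℝ} (hδ : 0 < δ) :
    ∀ᶠ x : ℝ in atTop, A * x ^ k ≤ Real.exp (δ * x) := by
  have h := (isLittleO_pow_exp_pos_mul_atTop k hδ).bound (c := (|A| + 1)⁻¹) (by positivity)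
  filter_upwards [h, eventually_ge_atTop 0] with x hx hx0
  rw [Real.norm_eq_abs, Real.norm_eq_abs, abs_of_nonneg (by positivity),
    abs_of_pos (Real.exp_pos _), ← div_eq_inv_mul, le_div_iff₀ (by positivity)] at hx
  have h1 : A ≤ |A| := le_abs_self A
  have h2 : 0 ≤ x ^ k := by positivity
  nlinarith

/-- Under the Lindelöf hypothesis `|L(s, χ)| ≤ q ^ δ` in the strip `1/2 ≤ σ ≤ 2`, `|t| ≤ 3 log q`,
for every `δ > 0` and all large `q`. -/
lemma eventually_norm_entireL_le (hGLH : GeneralizedLindelof) {δ : ℝ} (hδ : 0 < δ) :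
    ∀ᶠ q : ℕ in atTop, ∀ [NeZero q] (χ : DirichletCharacter ℂ q) (z : ℂ), 1 / 2 ≤ z.re →
      z.re ≤ 2 → |z.im| ≤ 3 * Real.log q → ‖entireL χ z‖ ≤ Real.exp (δ * Real.log q) := by
  obtain ⟨C, hC, hL⟩ := hGLH (δ / 4) (by positivity)
  filter_upwards [tendsto_log_natCast_atTop.eventually
    (eventually_mul_pow_le_exp 1 (5 * C) (half_pos hδ)),
    tendsto_log_natCast_atTop.eventually (eventually_mul_pow_le_exp 1 4 one_pos),
    tendsto_log_natCast_atTop.eventually (eventually_ge_atTop 1)] with q h1 h2 h3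
  intro _ χ z hz hz2 hzi
  set X := Real.log q
  have hq : (q : ℝ) = Real.exp X :=
    (Real.exp_log (by exact_mod_cast Nat.pos_of_ne_zero (NeZero.ne q))).symm
  refine (norm_entireL_le_of_bound χ hC (by positivity) (T := 3 * X) (by linarith)
    (fun s => hL q χ s) hz hz2 hzi).trans ?_
  have h4 : ((q : ℝ) * (1 + 3 * X)) ^ (δ / 4) ≤ Real.exp (δ / 2 * X) := by
    have : (q : ℝ) * (1 + 3 * X) ≤ Real.exp (2 * X) := by
      rw [hq, two_mul, Real.exp_add]
      gcongr
      rw [one_mul, pow_one] at h2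
      linarith
    refine (Real.rpow_le_rpow (by positivity) this (by positivity)).trans ?_
    rw [← Real.exp_mul]
    exact Real.exp_le_exp.2 (le_of_eq (by ring))
  have h5 : (2 + 3 * X) * C ≤ Real.exp (δ / 2 * X) := by
    refine le_trans ?_ h1
    rw [pow_one]
    nlinarith
  calc (2 + 3 * X) * (C * ((q : ℝ) * (1 + 3 * X)) ^ (δ / 4))
      = ((2 + 3 * X) * C) * ((q : ℝ) * (1 + 3 * X)) ^ (δ / 4) := by ring
    _ ≤ Real.exp (δ / 2 * X) * Real.exp (δ / 2 * X) := by gcongr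
    _ = Real.exp (δ * X) := by rw [← Real.exp_add]; congr 1; ring

/-- On the line `σ = 1 + a / log q` the trivial lower bound is of order `(log q) ^ (-2)`, which is
better than any negative power of `q`. -/
lemma eventually_le_norm_entireL {δ a : ℝ} (hδ : 0 < δ) (ha : 0 < a) :
    ∀ᶠ q : ℕ in atTop, ∀ [NeZero q] (χ : DirichletCharacter ℂ q) (s : ℂ),
      s.re = 1 + a / Real.log q → Real.exp (-(δ * Real.log q)) ≤ ‖entireL χ s‖ := by
  filter_upwards [tendsto_log_natCast_atTop.eventually
    (eventually_mul_pow_le_exp 2 (2 / a ^ 2) hδ),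
    tendsto_log_natCast_atTop.eventually (eventually_ge_atTop a)] with q h1 h2
  intro _ χ s hs
  set X := Real.log q
  have hX : 0 < X := ha.trans_le h2
  have hb : 0 < a / X := by positivity
  have hb1 : a / X ≤ 1 := (div_le_one hX).2 h2
  have hs1 : 1 < s.re := by linarith
  have hL : a / X / 2 ≤ ‖LFunction χ s‖ := by
    refine le_trans ?_ (le_norm_LFunction χ hs1)
    rw [hs, add_sub_cancel_left]
    gcongr
    linarith
  have h3 : a / X / 2 * (a / X) ≤ ‖entireL χ s‖ := by
    by_cases hχ : χ = 1
    · subst hχ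
      rw [entireL_one_apply (by rintro rfl; simp at hs1), norm_mul, mul_comm]
      have : a / X ≤ ‖s - 1‖ := by
        have := (le_abs_self _).trans (Complex.abs_re_le_norm (s - 1))
        rw [sub_re, one_re, hs] at this
        linarith
      gcongr
    · rw [entireL_of_ne_one hχ]
      exact (mul_le_of_le_one_right (by positivity) hb1).trans hL
  refine le_trans ?_ h3
  rw [Real.exp_neg]
  refine (inv_anti₀ (by positivity) h1).trans (le_of_eq ?_)
  field_simp

open Classical in
/-- The basic inequality: at `c = 1 + a / log q + it`, up to an error `δ log q`, the quantity
`-Re (L'/L)(c, χ)` is at most the contribution of the pole of `L(s, χ₀)` minus the contribution of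
any one or two zeros within distance `1/2`. -/
lemma eventually_negReLogDerivL_le (hGLH : GeneralizedLindelof) {δ a : ℝ} (hδ : 0 < δ)
    (ha : 0 < a) :
    ∀ᶠ q : ℕ in atTop, ∀ [NeZero q] (χ : DirichletCharacter ℂ q) (t : ℝ),
      |t| ≤ 2 * Real.log q → ∀ (c : ℂ), c = ((1 + a / Real.log q : ℝ) : ℂ) + t * I →
      ∀ (l : List ℂ) (h : ℂ → ℂ), l.length ≤ 2 → Differentiable ℂ h →
      (∀ z, entireL χ z = (l.map (fun ρ => z - ρ)).prod * h z) →
      (∀ ρ ∈ l, ρ ∈ Metric.ball c (1 / 2)) →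
      negReLogDerivL χ c ≤ (if χ = 1 then (1 / (c - 1)).re else 0)
        - (l.map (fun ρ => (1 / (c - ρ)).re)).sum + δ * Real.log q := by
  filter_upwards [eventually_norm_entireL_le hGLH (δ := δ / 9) (by positivity),
    eventually_le_norm_entireL (δ := δ / 9) (a := a) (by positivity) ha,
    tendsto_log_natCast_atTop.eventually (eventually_ge_atTop (max (2 * a) 1)),
    tendsto_log_natCast_atTop.eventually (eventually_ge_atTop (36 / δ))] with q h1 h2 h3 h4
  intro _ χ t ht c hc l h hlen hh hfh hl
  set X := Real.log q
  have hX1 : 1 ≤ X := (le_max_right _ _).trans h3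
  have hXa : 2 * a ≤ X := (le_max_left _ _).trans h3
  have hX : 0 < X := by linarith
  have haX : a / X ≤ 1 / 2 := by rw [div_le_iff₀ hX]; linarith
  have haX0 : 0 < a / X := by positivity
  have hcre : c.re = 1 + a / X := by rw [hc]; simp
  have hcim : c.im = t := by rw [hc]; simp
  have hcre1 : 1 < c.re := by linarith
  have key := neg_re_logDeriv_le (f := entireL χ) (R := 1 / 2) (M := 2 * (δ / 9) * X) (by norm_num)
    (by positivity) l hh hfh hl (entireL_ne_zero_of_one_le_re χ hcre1.le) ?_ ?_
  · rw [negReLogDerivL_eq χ hcre1]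
    have hsum : (l.map (fun ρ => (c - ρ).re / (1 / 2) ^ 2 - (1 / (c - ρ)).re)).sum
        ≤ 4 - (l.map (fun ρ => (1 / (c - ρ)).re)).sum := by
      have hsub : ∀ (l : List ℂ) (u v : ℂ → ℝ), (l.map fun ρ => u ρ - v ρ).sum
          = (l.map u).sum - (l.map v).sum := by
        intro l u v
        induction l with
        | nil => simp
        | cons b l ih => simp only [List.map_cons, List.sum_cons, ih]; ring
      rw [hsub]
      have hle : (l.map (fun ρ => (c - ρ).re / (1 / 2) ^ 2)).sum
          ≤ (l.map (fun ρ => (c - ρ).re / (1 / 2) ^ 2)).length • (2 : ℝ) := by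
        refine List.sum_le_card_nsmul _ _ fun x hx => ?_
        obtain ⟨ρ, hρ, rfl⟩ := List.mem_map.1 hx
        have h5 : ‖c - ρ‖ < 1 / 2 := by
          have := hl ρ hρ
          rwa [Metric.mem_ball, dist_comm, dist_eq_norm] at this
        have h6 := (le_abs_self _).trans (Complex.abs_re_le_norm (c - ρ))
        rw [div_le_iff₀ (by norm_num)]
        linarith
      rw [List.length_map, nsmul_eq_mul] at hle
      have : (l.length : ℝ) ≤ 2 := by exact_mod_cast hlen
      linarith
    -- the Blaschke corrections cost at most `4`, Borel–Carathéodory costs `8 (δ / 9) log q`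
    have h5 : 4 ≤ δ / 9 * X := by
      rw [div_le_iff₀ hδ] at h4
      linarith
    have h6 : 2 * (2 * (δ / 9) * X) / (1 / 2) = 8 * (δ / 9 * X) := by ring
    rw [h6] at key
    linarith
  · intro z hz
    by_contra hlt
    rw [not_le] at hlt
    exact entireL_ne_zero_of_one_le_re χ (by linarith) hz
  · intro z hz
    rw [Metric.mem_closedBall, dist_eq_norm] at hz
    have h5 := abs_le.1 ((Complex.abs_re_le_norm (z - c)).trans hz)
    have h6 := abs_le.1 ((Complex.abs_im_le_norm (z - c)).trans hz)
    rw [sub_re, hcre] at h5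
    rw [sub_im, hcim] at h6
    have ht' := abs_le.1 ht
    refine (h1 χ z (by linarith) (by linarith) (abs_le.2 ⟨by linarith, by linarith⟩)).trans ?_
    have h7 := h2 χ c hcre
    calc Real.exp (δ / 9 * X)
        = Real.exp (2 * (δ / 9) * X) * Real.exp (-(δ / 9 * X)) := by
          rw [← Real.exp_add]; congr 1; ring
      _ ≤ _ := by gcongr

/-! ### Zeros near the line `σ = 1` -/

/-- The radius does not depend on the modulus, since `ζ` has no zeros near its pole and the other
factors `1 - p ^ (-s)` of `L(s, χ₀)` do not vanish for `σ > 0`. -/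
lemma exists_entireL_one_ne_zero :
    ∃ r : ℝ, 0 < r ∧ ∀ (q : ℕ) [NeZero q] (s : ℂ), ‖s - 1‖ < r →
      entireL (1 : DirichletCharacter ℂ q) s ≠ 0 := by
  have h1 : ∀ᶠ s : ℂ in 𝓝[≠] 1, (s - 1) * riemannZeta s ≠ 0 :=
    riemannZeta_residue_one.eventually_ne one_ne_zero
  rw [eventually_nhdsWithin_iff, Metric.eventually_nhds_iff] at h1
  obtain ⟨r, hr, h⟩ := h1
  refine ⟨min r (1 / 2), by positivity, fun q _ s hs => ?_⟩
  rcases eq_or_ne s 1 with rfl | hs1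
  · exact entireL_ne_zero_of_one_le_re 1 (by simp)
  have h2 := h (y := s) (by rw [dist_eq_norm]; exact hs.trans_le (min_le_left _ _)) hs1
  have hre : 0 < s.re := by
    have h3 := abs_lt.1 ((Complex.abs_re_le_norm (s - 1)).trans_lt
      (hs.trans_le (min_le_right _ _)))
    rw [sub_re, one_re] at h3
    linarith
  rw [entireL_one_apply hs1]
  have h4 := LFunctionTrivChar_eq_mul_riemannZeta (N := q) hs1
  rw [LFunctionTrivChar] at h4
  rw [h4, mul_left_comm]
  refine mul_ne_zero (Finset.prod_ne_zero_iff.2 fun p hp => ?_) h2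
  have hp := Nat.prime_of_mem_primeFactors hp
  intro h0
  have h5 : ‖(p : ℂ) ^ (-s)‖ = 1 := by rw [← sub_eq_zero.1 h0, norm_one]
  rw [Complex.norm_natCast_cpow_of_pos hp.pos, neg_re] at h5
  have h6 : (p : ℝ) ^ (-s.re) < 1 :=
    Real.rpow_lt_one_of_one_lt_of_neg (by exact_mod_cast hp.one_lt) (by linarith)
  exact h6.ne h5

/-- For a real character, `L(s̄, χ)` is the complex conjugate of `L(s, χ)`. -/
lemma LFunction_conj_of_real {q : ℕ} [NeZero q] {χ : DirichletCharacter ℂ q} (hχ : χ ≠ 1)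
    (hreal : ∀ a : ZMod q, (χ a).im = 0) (s : ℂ) :
    LFunction χ ((starRingEnd ℂ) s) = (starRingEnd ℂ) (LFunction χ s) := by
  have hd := differentiable_LFunction hχ
  have hd' : Differentiable ℂ (fun z => (starRingEnd ℂ) (LFunction χ ((starRingEnd ℂ) z))) :=
    fun z => differentiableAt_conj_conj_iff.2 (hd _)
  have heq : ∀ z : ℂ, 1 < z.re →
      (starRingEnd ℂ) (LFunction χ ((starRingEnd ℂ) z)) = LFunction χ z := by
    intro z hz
    rw [LFunction_eq_LSeries χ (by rwa [conj_re]), LFunction_eq_LSeries χ hz, LSeries, LSeries,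
      conj_tsum]
    refine tsum_congr fun n => ?_
    rw [LSeries.term_def, LSeries.term_def]
    split_ifs with hn
    · simp
    · rw [map_div₀, ← conj_cpow _ _ (by rw [natCast_arg]; exact Real.pi_pos.ne), conj_natCast,
        conj_eq_iff_im.2 (hreal _)]
  have hall := (hd'.differentiableOn.analyticOnNhd isOpen_univ).eqOn_of_preconnected_of_eventuallyEq
    (hd.differentiableOn.analyticOnNhd isOpen_univ) isPreconnected_univ (Set.mem_univ (2 : ℂ))
    (by
      filter_upwards [(isOpen_lt continuous_const Complex.continuous_re).mem_nhds
        (show (1 : ℝ) < (2 : ℂ).re by norm_num)] with z hz using heq z hz)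
  have := hall (Set.mem_univ s)
  rw [← this]
  simp

lemma exists_eq_sub_mul {f : ℂ → ℂ} (hf : Differentiable ℂ f) {ρ : ℂ} (hρ : f ρ = 0) :
    ∃ g : ℂ → ℂ, Differentiable ℂ g ∧ ∀ z, f z = (z - ρ) * g z := by
  obtain ⟨g, hg, hfg⟩ := exists_eq_sub_pow_mul hf ρ 1 (by
    rw [Nat.cast_one, Order.one_le_iff_ne_zero]
    exact (hf.analyticAt ρ).analyticOrderAt_ne_zero.2 hρ)
  exact ⟨g, hg, fun z => by rw [hfg, pow_one]⟩

lemma re_lt_one_of_entireL_eq_zero {q : ℕ} [NeZero q] {χ : DirichletCharacter ℂ q} {ρ : ℂ}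
    (hρ : entireL χ ρ = 0) : ρ.re < 1 := by
  by_contra h
  exact entireL_ne_zero_of_one_le_re χ (not_lt.1 h) hρ

/-- Zeros in the region belong to real non-principal characters and have `|γ| ≤ 100 η / log q`.
This is the classical zero-free region argument with `σ = 1 + 6 η / log q`; the constant `η` is
arbitrary because the error term is `δ log q` with `δ` as small as desired. -/
lemma eventually_zero_near_real_axis (hGLH : GeneralizedLindelof) {η : ℝ} (hη : 1 ≤ η) :
    ∀ᶠ q : ℕ in atTop, ∀ [NeZero q] (χ : DirichletCharacter ℂ q) (ρ : ℂ), entireL χ ρ = 0 →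
      ρ ∈ nearOneRegion η q → χ ≠ 1 ∧ χ ^ 2 = 1 ∧ |ρ.im| * Real.log q ≤ 100 * η := by
  have hη0 : 0 < η := by linarith
  obtain ⟨r, hr, hr1⟩ := exists_entireL_one_ne_zero
  filter_upwards [eventually_negReLogDerivL_le hGLH (δ := 1 / (1000 * η)) (a := 6 * η)
    (by positivity) (by positivity),
    tendsto_log_natCast_atTop.eventually (eventually_gt_atTop (max (14 * η) (101 * η / r)))]
    with q hmain hX'
  intro _ χ ρ hρ hreg
  set X := Real.log q
  have hX14 : 14 * η < X := (le_max_left _ _).trans_lt hX'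
  have hXr : 101 * η / r < X := (le_max_right _ _).trans_lt hX'
  have hX : 0 < X := by linarith
  obtain ⟨hre, him⟩ : 1 - η / X ≤ ρ.re ∧ |ρ.im| ≤ X := hreg
  have hre1 := re_lt_one_of_entireL_eq_zero hρ
  have hclaim : χ ^ 2 = 1 ∧ |ρ.im| * X ≤ 100 * η := by
    by_contra hcon
    obtain ⟨h, hh, hfh⟩ := exists_eq_sub_mul (differentiable_entireL χ) hρ
    have hσ : 1 < 1 + 6 * η / X := by
      have : 0 < 6 * η / X := by positivity
      linarith
    have h341 := three_four_one_negReLogDerivL χ hσ ρ.im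
    have e1 := hmain (1 : DirichletCharacter ℂ q) 0 (by simp; positivity)
      ((1 + 6 * η / X : ℝ) : ℂ) (by simp) [] (entireL (1 : DirichletCharacter ℂ q)) (by simp)
      (differentiable_entireL _) (by simp) (by simp)
    have e2 := hmain χ ρ.im (by linarith) _ rfl [ρ] h (by simp) hh (by simpa using hfh) ?_
    have e3 := hmain (χ ^ 2) (2 * ρ.im) (by rw [abs_mul, abs_two]; linarith) _ rfl []
      (entireL (χ ^ 2)) (by simp) (differentiable_entireL _) (by simp) (by simp)
    · have hpole : ∀ t : ℝ, |ρ.im| ≤ |t| → 100 * η < |ρ.im| * X →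
          (1 / ((((1 + 6 * η / X : ℝ) : ℂ) + t * I) - 1)).re ≤ X / (1600 * η) := by
        intro t ht hT
        have h1 : (((1 + 6 * η / X : ℝ) : ℂ) + t * I) - 1 = ((6 * η / X : ℝ) : ℂ) + t * I := by
          push_cast; ring
        rw [h1, one_div, Complex.inv_re, Complex.normSq_add_mul_I]
        have h2 : (((6 * η / X : ℝ) : ℂ) + t * I).re = 6 * η / X := by simp
        rw [h2, div_le_div_iff₀ (by positivity) (by positivity)]
        have h3 : 100 * η / X ≤ |t| := ((div_le_iff₀ hX).2 hT.le).trans ht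
        have h4 : (100 * η / X) ^ 2 ≤ t ^ 2 := by
          rw [← sq_abs t]; gcongr
        have h5 : 6 * η / X * (1600 * η) ≤ X * (100 * η / X) ^ 2 := by
          have : X * (100 * η / X) ^ 2 = 10000 * η ^ 2 / X := by field_simp; ring
          rw [this, div_mul_eq_mul_div]
          refine div_le_div_of_nonneg_right ?_ hX.le
          nlinarith [mul_pos hη0 hη0]
        have h6 : 0 ≤ (6 * η / X) ^ 2 := by positivity
        nlinarith
      have hp1 : (1 / ((((1 + 6 * η / X : ℝ) : ℂ)) - 1)).re = X / (6 * η) := by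
        have h1 : (((1 + 6 * η / X : ℝ) : ℂ)) - 1 = ((6 * η / X : ℝ) : ℂ) := by
          push_cast; ring
        rw [h1, ← Complex.ofReal_one, ← Complex.ofReal_div, Complex.ofReal_re, one_div_div]
      have hzero : X / (7 * η) ≤ (1 / ((((1 + 6 * η / X : ℝ) : ℂ) + ρ.im * I) - ρ)).re := by
        have h1 : (((1 + 6 * η / X : ℝ) : ℂ) + ρ.im * I) - ρ
            = ((1 + 6 * η / X - ρ.re : ℝ) : ℂ) := by
          apply Complex.ext <;> simp
        rw [h1, ← Complex.ofReal_one, ← Complex.ofReal_div, Complex.ofReal_re]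
        have h2 : 1 + 6 * η / X - ρ.re ≤ 7 * η / X := by
          have : 7 * η / X = 6 * η / X + η / X := by ring
          linarith
        rw [← one_div_div]
        exact one_div_le_one_div_of_le (by linarith) h2
      have hχpole : (if χ = 1 then
          (1 / ((((1 + 6 * η / X : ℝ) : ℂ) + ρ.im * I) - 1)).re else 0) ≤ X / (1600 * η) := by
        split_ifs with h1
        · refine hpole _ le_rfl ?_
          by_contra h2
          exact hcon ⟨by rw [h1, one_pow], not_lt.1 h2⟩
        · positivity
      have hχ2pole : (if χ ^ 2 = 1 then
          (1 / ((((1 + 6 * η / X : ℝ) : ℂ) + (2 * ρ.im : ℝ) * I) - 1)).re else 0)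
          ≤ X / (1600 * η) := by
        split_ifs with h1
        · refine hpole _ (by rw [abs_mul, abs_two]; linarith [abs_nonneg ρ.im]) ?_
          by_contra h2
          exact hcon ⟨h1, not_lt.1 h2⟩
        · positivity
      rw [if_pos rfl, hp1] at e1
      simp only [List.map_nil, List.sum_nil, List.map_cons, List.sum_cons, add_zero, sub_zero]
        at e1 e2 e3
      -- in units of `Y = X / η`: `3/6 - 4/7 + 5/1600 + 8/1000 < 0`
      have hY : 0 < X / η := by positivity
      have s1 : X / (6 * η) = X / η / 6 := by field_simp
      have s2 : X / (7 * η) = X / η / 7 := by field_simp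
      have s3 : X / (1600 * η) = X / η / 1600 := by field_simp
      have s4 : 1 / (1000 * η) * X = X / η / 1000 := by field_simp
      rw [s1] at e1
      rw [s2] at hzero
      rw [s3] at hχpole hχ2pole
      rw [s4] at e1 e2 e3
      linarith
    · intro σ hσ'
      rw [List.mem_singleton] at hσ'
      subst hσ'
      rw [Metric.mem_ball, dist_comm, dist_eq_norm]
      have h1 : (((1 + 6 * η / X : ℝ) : ℂ) + σ.im * I) - σ
          = ((1 + 6 * η / X - σ.re : ℝ) : ℂ) := by
        apply Complex.ext <;> simp
      rw [h1, Complex.norm_real, Real.norm_eq_abs, abs_of_pos (by linarith)]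
      have : 6 * η / X + η / X < 1 / 2 := by
        rw [← add_div, div_lt_iff₀ hX]
        linarith
      linarith
  refine ⟨?_, hclaim.1, hclaim.2⟩
  -- a zero of `L(s, χ₀)` would now be within `101 η / log q < r` of the pole
  rintro rfl
  refine hr1 q ρ ?_ hρ
  have h1 : ‖ρ - 1‖ ≤ |ρ.re - 1| + |ρ.im| := by
    simpa using Complex.norm_le_abs_re_add_abs_im (ρ - 1)
  have h2 : |ρ.re - 1| ≤ η / X := abs_le.2 ⟨by linarith, by linarith [div_pos hη0 hX]⟩
  have h3 : |ρ.im| ≤ 100 * η / X := (le_div_iff₀ hX).2 hclaim.2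
  have h4 : η / X + 100 * η / X < r := by
    rw [← add_div, div_lt_iff₀ hX]
    rw [div_lt_iff₀ hr] at hXr
    linarith
  linarith

/-- The contribution of a zero near `s = 1`, seen from a point `1 + a / X` with `a = 1000 η` much
larger than the distance of the zero, is more than half of the contribution `X / a` of a pole at
`s = 1`. -/
lemma le_re_one_div_sub_of_near {η X : ℝ} (hη : 0 < η) (hX : 0 < X) {ρ : ℂ}
    (h1 : 1 - η / X ≤ ρ.re) (h2 : ρ.re < 1) (h3 : |ρ.im| * X ≤ 100 * η) :
    X / η * (6 / 10000) ≤ (1 / (((1 + 1000 * η / X : ℝ) : ℂ) - ρ)).re := by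
  set u := 1 + 1000 * η / X - ρ.re with hu
  have hu1 : 1000 * η ≤ u * X := by
    have : 1000 * η / X ≤ u := by linarith
    rwa [div_le_iff₀ hX] at this
  have hu2 : u * X ≤ 1001 * η := by
    have : u ≤ 1001 * η / X := by
      have : 1001 * η / X = 1000 * η / X + η / X := by ring
      linarith
    rwa [le_div_iff₀ hX] at this
  have hc : ((1 + 1000 * η / X : ℝ) : ℂ) - ρ = (u : ℂ) + (-ρ.im : ℝ) * I := by
    apply Complex.ext <;> simp [hu]
  have hu0 : 0 < u := by
    by_contra h
    nlinarith [not_lt.1 h]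
  have h4 : (ρ.im * X) ^ 2 ≤ (100 * η) ^ 2 := by
    rw [← sq_abs, abs_mul, abs_of_pos hX]
    gcongr
  rw [hc, one_div, Complex.inv_re, Complex.normSq_add_mul_I]
  have h5 : ((u : ℂ) + (-ρ.im : ℝ) * I).re = u := by simp
  rw [h5, le_div_iff₀ (by positivity)]
  have h6 : X / η * (6 / 10000) * (u ^ 2 + (-ρ.im) ^ 2)
      = ((u * X) ^ 2 + (ρ.im * X) ^ 2) * (6 / 10000) / (η * X) := by field_simp
  rw [h6, div_le_iff₀ (by positivity)]
  nlinarith [mul_pos hη hη]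

lemma mem_ball_of_near {η X : ℝ} (hη : 0 < η) (hX : 2202 * η < X) {ρ : ℂ}
    (h1 : 1 - η / X ≤ ρ.re) (h2 : ρ.re < 1) (h3 : |ρ.im| * X ≤ 100 * η) :
    ρ ∈ Metric.ball ((1 + 1000 * η / X : ℝ) : ℂ) (1 / 2) := by
  have hX0 : 0 < X := by linarith
  rw [Metric.mem_ball, dist_eq_norm]
  refine (Complex.norm_le_abs_re_add_abs_im _).trans_lt ?_
  rw [sub_re, sub_im, ofReal_re, ofReal_im, sub_zero]
  have h4 : |ρ.im| ≤ 100 * η / X := (le_div_iff₀ hX0).2 h3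
  have h5 : |ρ.re - (1 + 1000 * η / X)| ≤ 1001 * η / X := by
    have : 1001 * η / X = 1000 * η / X + η / X := by ring
    have h6 : 0 < 1000 * η / X := by positivity
    have h7 : 0 < η / X := by positivity
    exact abs_le.2 ⟨by linarith, by linarith⟩
  have h6 : 1001 * η / X + 100 * η / X < 1 / 2 := by
    rw [← add_div, div_lt_iff₀ hX0]
    linarith
  linarith

/-- Two different real non-principal characters cannot both have a zero near `s = 1`. -/
lemma eventually_not_zero_of_two_characters (hGLH : GeneralizedLindelof) {η : ℝ} (hη : 1 ≤ η) :
    ∀ᶠ q : ℕ in atTop, ∀ [NeZero q] (χ₁ χ₂ : DirichletCharacter ℂ q) (ρ₁ ρ₂ : ℂ), χ₁ ≠ χ₂ →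
      χ₁ ≠ 1 → χ₂ ≠ 1 → χ₁ ^ 2 = 1 → χ₂ ^ 2 = 1 → entireL χ₁ ρ₁ = 0 → entireL χ₂ ρ₂ = 0 →
      1 - η / Real.log q ≤ ρ₁.re → 1 - η / Real.log q ≤ ρ₂.re →
      |ρ₁.im| * Real.log q ≤ 100 * η → |ρ₂.im| * Real.log q ≤ 100 * η → False := by
  have hη0 : 0 < η := by linarith
  filter_upwards [eventually_negReLogDerivL_le hGLH (δ := 1 / (100000 * η)) (a := 1000 * η)
    (by positivity) (by positivity),
    tendsto_log_natCast_atTop.eventually (eventually_gt_atTop (2202 * η))] with q hmain hX'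
  intro _ χ₁ χ₂ ρ₁ ρ₂ hne h₁ h₂ hs₁ hs₂ hz₁ hz₂ hr₁ hr₂ hi₁ hi₂
  set X := Real.log q
  have hX : 0 < X := by linarith
  have hσ : 1 < 1 + 1000 * η / X := by
    have : 0 < 1000 * η / X := by positivity
    linarith
  have h12 : χ₁ * χ₂ ≠ 1 := by
    intro h
    apply hne
    calc χ₁ = χ₁ * χ₂ ^ 2 := by rw [hs₂, mul_one]
      _ = χ₁ * χ₂ * χ₂ := by rw [sq, mul_assoc]
      _ = χ₂ := by rw [h, one_mul]
  have hpos := negReLogDerivL_add_of_sq_eq_one hs₁ hs₂ hσ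
  obtain ⟨g₁, hg₁, hf₁⟩ := exists_eq_sub_mul (differentiable_entireL χ₁) hz₁
  obtain ⟨g₂, hg₂, hf₂⟩ := exists_eq_sub_mul (differentiable_entireL χ₂) hz₂
  have hb₁ := re_lt_one_of_entireL_eq_zero hz₁
  have hb₂ := re_lt_one_of_entireL_eq_zero hz₂
  have h0 : |(0 : ℝ)| ≤ 2 * X := by simp; positivity
  have e0 := hmain (1 : DirichletCharacter ℂ q) 0 h0 ((1 + 1000 * η / X : ℝ) : ℂ) (by simp) []
    (entireL (1 : DirichletCharacter ℂ q)) (by simp) (differentiable_entireL _) (by simp) (by simp)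
  have e1 := hmain χ₁ 0 h0 ((1 + 1000 * η / X : ℝ) : ℂ) (by simp) [ρ₁] g₁ (by simp) hg₁
    (by simpa using hf₁) (by simpa using mem_ball_of_near hη0 hX' hr₁ hb₁ hi₁)
  have e2 := hmain χ₂ 0 h0 ((1 + 1000 * η / X : ℝ) : ℂ) (by simp) [ρ₂] g₂ (by simp) hg₂
    (by simpa using hf₂) (by simpa using mem_ball_of_near hη0 hX' hr₂ hb₂ hi₂)
  have e3 := hmain (χ₁ * χ₂) 0 h0 ((1 + 1000 * η / X : ℝ) : ℂ) (by simp) [] (entireL (χ₁ * χ₂))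
    (by simp) (differentiable_entireL _) (by simp) (by simp)
  have hp1 : (1 / ((((1 + 1000 * η / X : ℝ) : ℂ)) - 1)).re = X / η / 1000 := by
    have h1 : (((1 + 1000 * η / X : ℝ) : ℂ)) - 1 = ((1000 * η / X : ℝ) : ℂ) := by
      push_cast; ring
    rw [h1, ← Complex.ofReal_one, ← Complex.ofReal_div, Complex.ofReal_re, one_div_div]
    field_simp
  have l1 := le_re_one_div_sub_of_near hη0 hX hr₁ hb₁ hi₁
  have l2 := le_re_one_div_sub_of_near hη0 hX hr₂ hb₂ hi₂
  have s4 : 1 / (100000 * η) * X = X / η / 100000 := by field_simp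
  have hY : 0 < X / η := by positivity
  -- in units of `X / η`: `1/1000 - 2 * 6/10000 + 4/100000 < 0`
  rw [if_pos rfl, hp1, s4] at e0
  rw [if_neg h₁, s4] at e1
  rw [if_neg h₂, s4] at e2
  rw [if_neg h12, s4] at e3
  simp only [List.map_nil, List.sum_nil, List.map_cons, List.sum_cons, add_zero, sub_zero]
    at e0 e1 e2 e3
  linarith

/-- `L(s, χ)`, `χ` non-principal, cannot have two zeros near `s = 1`; `ρ₁ = ρ₂` is allowed and
means a multiple zero. -/
lemma eventually_not_two_zeros (hGLH : GeneralizedLindelof) {η : ℝ} (hη : 1 ≤ η) :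
    ∀ᶠ q : ℕ in atTop, ∀ [NeZero q] (χ : DirichletCharacter ℂ q) (ρ₁ ρ₂ : ℂ) (h : ℂ → ℂ),
      χ ≠ 1 → Differentiable ℂ h → (∀ z, entireL χ z = (z - ρ₁) * ((z - ρ₂) * h z)) →
      1 - η / Real.log q ≤ ρ₁.re → 1 - η / Real.log q ≤ ρ₂.re →
      |ρ₁.im| * Real.log q ≤ 100 * η → |ρ₂.im| * Real.log q ≤ 100 * η → False := by
  have hη0 : 0 < η := by linarith
  filter_upwards [eventually_negReLogDerivL_le hGLH (δ := 1 / (100000 * η)) (a := 1000 * η)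
    (by positivity) (by positivity),
    tendsto_log_natCast_atTop.eventually (eventually_gt_atTop (2202 * η))] with q hmain hX'
  intro _ χ ρ₁ ρ₂ h hχ hh hf hr₁ hr₂ hi₁ hi₂
  set X := Real.log q
  have hX : 0 < X := by linarith
  have hσ : 1 < 1 + 1000 * η / X := by
    have : 0 < 1000 * η / X := by positivity
    linarith
  have hpos := negReLogDerivL_one_add_nonneg χ hσ
  have hb₁ := re_lt_one_of_entireL_eq_zero (χ := χ) (ρ := ρ₁) (by rw [hf]; simp)
  have hb₂ := re_lt_one_of_entireL_eq_zero (χ := χ) (ρ := ρ₂) (by rw [hf]; simp)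
  have h0 : |(0 : ℝ)| ≤ 2 * X := by simp; positivity
  have e0 := hmain (1 : DirichletCharacter ℂ q) 0 h0 ((1 + 1000 * η / X : ℝ) : ℂ) (by simp) []
    (entireL (1 : DirichletCharacter ℂ q)) (by simp) (differentiable_entireL _) (by simp) (by simp)
  have e1 := hmain χ 0 h0 ((1 + 1000 * η / X : ℝ) : ℂ) (by simp) [ρ₁, ρ₂] h (by simp) hh
    (fun z => by rw [hf z]; simp [mul_assoc]) (by
      intro ρ hρ
      simp only [List.mem_cons, List.not_mem_nil, or_false] at hρ
      rcases hρ with rfl | rfl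
      · exact mem_ball_of_near hη0 hX' hr₁ hb₁ hi₁
      · exact mem_ball_of_near hη0 hX' hr₂ hb₂ hi₂)
  have hp1 : (1 / ((((1 + 1000 * η / X : ℝ) : ℂ)) - 1)).re = X / η / 1000 := by
    have h1 : (((1 + 1000 * η / X : ℝ) : ℂ)) - 1 = ((1000 * η / X : ℝ) : ℂ) := by
      push_cast; ring
    rw [h1, ← Complex.ofReal_one, ← Complex.ofReal_div, Complex.ofReal_re, one_div_div]
    field_simp
  have l1 := le_re_one_div_sub_of_near hη0 hX hr₁ hb₁ hi₁
  have l2 := le_re_one_div_sub_of_near hη0 hX hr₂ hb₂ hi₂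
  have s4 : 1 / (100000 * η) * X = X / η / 100000 := by field_simp
  have hY : 0 < X / η := by positivity
  -- in units of `X / η`: `1/1000 - 2 * 6/10000 + 2/100000 < 0`
  rw [if_pos rfl, hp1, s4] at e0
  rw [if_neg hχ, s4] at e1
  simp only [List.map_nil, List.sum_nil, List.map_cons, List.sum_cons, add_zero, sub_zero]
    at e0 e1
  linarith

/-! ### Orders of the product of all `L`-functions -/

lemma meromorphicAt_LFunction {q : ℕ} [NeZero q] (χ : DirichletCharacter ℂ q) (ρ : ℂ) :
    MeromorphicAt (LFunction χ) ρ := by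
  by_cases hχ : χ = 1
  · subst hχ
    have h1 : MeromorphicAt (fun z => entireL (1 : DirichletCharacter ℂ q) z / (z - 1)) ρ :=
      ((differentiable_entireL (1 : DirichletCharacter ℂ q)).analyticAt ρ).meromorphicAt.fun_div
        (by fun_prop)
    refine h1.congr ?_
    have h2 : ∀ᶠ z : ℂ in 𝓝[≠] ρ, z ≠ 1 := by
      rcases eq_or_ne ρ 1 with rfl | h
      · exact self_mem_nhdsWithin
      · exact mem_nhdsWithin_of_mem_nhds (isOpen_ne.mem_nhds h)
    filter_upwards [h2] with z hz
    rw [entireL_one_apply hz, mul_comm, mul_div_cancel_right₀ _ (sub_ne_zero.2 hz)]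
  · exact ((differentiable_LFunction hχ).analyticAt ρ).meromorphicAt

lemma meromorphicOrderAt_prodLFunction (q : ℕ) [NeZero q] (ρ : ℂ) :
    meromorphicOrderAt (prodLFunction q) ρ =
      ∑ χ : DirichletCharacter ℂ q, meromorphicOrderAt (LFunction χ) ρ := by
  have h : prodLFunction q = ∏ χ : DirichletCharacter ℂ q, LFunction χ := by
    ext s; rw [prodLFunction, Finset.prod_apply]
  rw [h, meromorphicOrderAt_prod fun χ _ => meromorphicAt_LFunction χ ρ]

lemma analyticAt_LFunction {q : ℕ} [NeZero q] (χ : DirichletCharacter ℂ q) {ρ : ℂ}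
    (h : ρ ≠ 1 ∨ χ ≠ 1) : AnalyticAt ℂ (LFunction χ) ρ := by
  by_cases hχ : χ = 1
  · have hρ : ρ ≠ 1 := h.resolve_right (not_not_intro hχ)
    refine DifferentiableOn.analyticAt (s := {1}ᶜ) (fun z hz => ?_)
      (isOpen_compl_singleton.mem_nhds hρ)
    exact (differentiableAt_LFunction χ z (.inl hz)).differentiableWithinAt
  · exact (differentiable_LFunction hχ).analyticAt ρ

lemma meromorphicOrderAt_LFunction_eq_zero {q : ℕ} [NeZero q] {χ : DirichletCharacter ℂ q} {ρ : ℂ}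
    (h : ρ ≠ 1 ∨ χ ≠ 1) (h0 : LFunction χ ρ ≠ 0) : meromorphicOrderAt (LFunction χ) ρ = 0 := by
  have ha := analyticAt_LFunction χ h
  rw [ha.meromorphicOrderAt_eq, ha.analyticOrderAt_eq_zero.2 h0]
  rfl

/-- A positive order would make `(s - 1) L(s, χ₀)` tend to `0` at `s = 1`, but the residue there is
not zero. -/
lemma meromorphicOrderAt_LFunction_one_le (q : ℕ) [NeZero q] :
    meromorphicOrderAt (LFunction (1 : DirichletCharacter ℂ q)) 1 ≤ 0 := by
  by_contra hlt
  rw [not_le] at hlt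
  have h1 := tendsto_zero_of_meromorphicOrderAt_pos hlt
  have h2 : Tendsto (fun s : ℂ => (s - 1) * LFunction (1 : DirichletCharacter ℂ q) s) (𝓝[≠] 1)
      (𝓝 (0 * 0)) := by
    refine Tendsto.mul ?_ h1
    refine tendsto_nhdsWithin_of_tendsto_nhds ?_
    have : Continuous fun s : ℂ => s - 1 := by fun_prop
    simpa using this.tendsto 1
  have h3 := tendsto_nhds_unique h2 (LFunctionTrivChar_residue_one (N := q))
  have h4 := LFunctionTrivChar₁_apply_one_ne_zero q
  simp only [LFunctionTrivChar₁, Function.update_self] at h4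
  rw [mul_zero] at h3
  exact h4 h3.symm

lemma ne_one_of_mem_zerosProdLFunction {q : ℕ} [NeZero q] {ρ : ℂ}
    (hρ : ρ ∈ zerosProdLFunction q) : ρ ≠ 1 := by
  rintro rfl
  have h : 0 < meromorphicOrderAt (prodLFunction q) 1 := hρ
  rw [meromorphicOrderAt_prodLFunction] at h
  refine h.not_ge (Finset.sum_nonpos fun χ _ => ?_)
  by_cases hχ : χ = 1
  · subst hχ; exact meromorphicOrderAt_LFunction_one_le q
  · exact (meromorphicOrderAt_LFunction_eq_zero (.inr hχ) (LFunction_apply_one_ne_zero hχ)).le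

lemma exists_LFunction_eq_zero_of_mem_zerosProdLFunction {q : ℕ} [NeZero q] {ρ : ℂ}
    (hρ : ρ ∈ zerosProdLFunction q) : ∃ χ : DirichletCharacter ℂ q, LFunction χ ρ = 0 := by
  by_contra hcon
  push Not at hcon
  have h : 0 < meromorphicOrderAt (prodLFunction q) ρ := hρ
  rw [meromorphicOrderAt_prodLFunction, Finset.sum_eq_zero fun χ _ =>
    meromorphicOrderAt_LFunction_eq_zero (.inl (ne_one_of_mem_zerosProdLFunction hρ)) (hcon χ)] at h
  exact lt_irrefl _ h

lemma entireL_eq_zero_of_LFunction_eq_zero {q : ℕ} [NeZero q] {χ : DirichletCharacter ℂ q} {ρ : ℂ}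
    (hρ1 : ρ ≠ 1) (h : LFunction χ ρ = 0) : entireL χ ρ = 0 := by
  by_cases hχ : χ = 1
  · subst hχ; rw [entireL_one_apply hρ1, h, mul_zero]
  · rw [entireL_of_ne_one hχ, h]

lemma im_eq_zero_of_sq_eq_one {q : ℕ} {χ : DirichletCharacter ℂ q} (hχ : χ ^ 2 = 1) (a : ZMod q) :
    (χ a).im = 0 := by
  by_cases hu : IsUnit a
  · have h := congrArg (fun ψ : DirichletCharacter ℂ q => ψ a) hχ
    simp only [MulChar.pow_apply' _ two_ne_zero, MulChar.one_apply hu] at h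
    rcases mul_self_eq_one_iff.1 ((sq _).symm.trans h) with h1 | h1 <;> simp [h1]
  · simp [MulChar.map_nonunit _ hu]

theorem mainTheorem4 (hGLH : GeneralizedLindelof) (η : ℝ) (hη : 1 ≤ η) :
    ∃ q₂ : ℕ, ∀ (q : ℕ) [NeZero q], q₂ ≤ q →
      (zerosProdLFunction q ∩ nearOneRegion η q).Subsingleton ∧
      ∀ ρ ∈ zerosProdLFunction q ∩ nearOneRegion η q,
        ρ.im = 0 ∧
        meromorphicOrderAt (prodLFunction q) ρ = 1 ∧
        ∃ χ : DirichletCharacter ℂ q,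
          χ ≠ 1 ∧ (∀ a : ZMod q, (χ a).im = 0) ∧
          analyticOrderAt (DirichletCharacter.LFunction χ) ρ = 1 ∧
          ∀ ψ : DirichletCharacter ℂ q, ψ ≠ χ → DirichletCharacter.LFunction ψ ρ ≠ 0 := by
  obtain ⟨q₂, hq₂⟩ := eventually_atTop.1 ((eventually_zero_near_real_axis hGLH hη).and
    ((eventually_not_zero_of_two_characters hGLH hη).and (eventually_not_two_zeros hGLH hη)))
  refine ⟨q₂, fun q _ hq => ?_⟩
  obtain ⟨hnear, htwoChar, htwoZero⟩ := hq₂ q hq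
  -- a character has at most one zero in the region
  have hdistinct : ∀ (χ : DirichletCharacter ℂ q) (ρ₁ ρ₂ : ℂ), entireL χ ρ₁ = 0 →
      entireL χ ρ₂ = 0 → ρ₁ ∈ nearOneRegion η q → ρ₂ ∈ nearOneRegion η q → ρ₁ = ρ₂ := by
    intro χ ρ₁ ρ₂ h₁ h₂ hr₁ hr₂
    by_contra hne
    obtain ⟨hχ, -, hi₁⟩ := hnear χ ρ₁ h₁ hr₁
    obtain ⟨-, -, hi₂⟩ := hnear χ ρ₂ h₂ hr₂
    obtain ⟨g, hg, hfg⟩ := exists_eq_sub_mul (differentiable_entireL χ) h₁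
    have hg0 : g ρ₂ = 0 := by
      rw [hfg] at h₂
      exact (mul_eq_zero.1 h₂).resolve_left (sub_ne_zero.2 (Ne.symm hne))
    obtain ⟨k, hk, hgk⟩ := exists_eq_sub_mul hg hg0
    exact htwoZero χ ρ₁ ρ₂ k hχ hk (fun z => by rw [hfg, hgk]) hr₁.1 hr₂.1 hi₁ hi₂
  -- at most one character has a zero in the region
  have hchar : ∀ (χ₁ χ₂ : DirichletCharacter ℂ q) (ρ₁ ρ₂ : ℂ), entireL χ₁ ρ₁ = 0 →
      entireL χ₂ ρ₂ = 0 → ρ₁ ∈ nearOneRegion η q → ρ₂ ∈ nearOneRegion η q → χ₁ = χ₂ := by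
    intro χ₁ χ₂ ρ₁ ρ₂ h₁ h₂ hr₁ hr₂
    by_contra hne
    obtain ⟨hχ₁, hs₁, hi₁⟩ := hnear χ₁ ρ₁ h₁ hr₁
    obtain ⟨hχ₂, hs₂, hi₂⟩ := hnear χ₂ ρ₂ h₂ hr₂
    exact htwoChar χ₁ χ₂ ρ₁ ρ₂ hne hχ₁ hχ₂ hs₁ hs₂ h₁ h₂ hr₁.1 hr₂.1 hi₁ hi₂
  have hzero : ∀ ρ ∈ zerosProdLFunction q, ∃ χ : DirichletCharacter ℂ q,
      LFunction χ ρ = 0 ∧ entireL χ ρ = 0 := by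
    intro ρ hρ
    obtain ⟨χ, hχ⟩ := exists_LFunction_eq_zero_of_mem_zerosProdLFunction hρ
    exact ⟨χ, hχ, entireL_eq_zero_of_LFunction_eq_zero (ne_one_of_mem_zerosProdLFunction hρ) hχ⟩
  constructor
  · rintro ρ₁ ⟨hz₁, hr₁⟩ ρ₂ ⟨hz₂, hr₂⟩
    obtain ⟨χ₁, -, h₁⟩ := hzero ρ₁ hz₁
    obtain ⟨χ₂, -, h₂⟩ := hzero ρ₂ hz₂
    obtain rfl := hchar χ₁ χ₂ ρ₁ ρ₂ h₁ h₂ hr₁ hr₂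
    exact hdistinct χ₁ ρ₁ ρ₂ h₁ h₂ hr₁ hr₂
  · rintro ρ ⟨hz, hr⟩
    have hρ1 := ne_one_of_mem_zerosProdLFunction hz
    obtain ⟨χ, hLχ, hEχ⟩ := hzero ρ hz
    obtain ⟨hχ1, hχ2, hi⟩ := hnear χ ρ hEχ hr
    have hreal := im_eq_zero_of_sq_eq_one hχ2
    have hother : ∀ ψ : DirichletCharacter ℂ q, ψ ≠ χ → LFunction ψ ρ ≠ 0 := fun ψ hψ h0 =>
      hψ (hchar ψ χ ρ ρ (entireL_eq_zero_of_LFunction_eq_zero hρ1 h0) hEχ hr hr)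
    have hsimple : analyticOrderAt (LFunction χ) ρ = 1 := by
      refine le_antisymm ?_ ?_
      · by_contra hlt
        rw [not_le] at hlt
        obtain ⟨g, hg, hfg⟩ := exists_eq_sub_pow_mul (differentiable_LFunction hχ1) ρ 2
          (by have := Order.add_one_le_of_lt hlt; rwa [one_add_one_eq_two] at this)
        exact htwoZero χ ρ ρ g hχ1 hg
          (fun z => by rw [entireL_of_ne_one hχ1, hfg]; ring) hr.1 hr.1 hi hi
      · rw [Order.one_le_iff_ne_zero]
        exact (analyticAt_LFunction χ (.inr hχ1)).analyticOrderAt_ne_zero.2 hLχ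
    refine ⟨?_, ?_, χ, hχ1, hreal, hsimple, hother⟩
    · -- the conjugate of a non-real zero would be a second zero
      have hconj : entireL χ ((starRingEnd ℂ) ρ) = 0 := by
        rw [entireL_of_ne_one hχ1, LFunction_conj_of_real hχ1 hreal, hLχ, map_zero]
      have hrc : (starRingEnd ℂ) ρ ∈ nearOneRegion η q := by
        refine ⟨?_, ?_⟩
        · rw [conj_re]; exact hr.1
        · rw [conj_im, abs_neg]; exact hr.2
      exact conj_eq_iff_im.1 (hdistinct χ _ ρ hconj hEχ hrc hr)
    · rw [meromorphicOrderAt_prodLFunction, Finset.sum_eq_single χ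
        (fun ψ _ hψ => meromorphicOrderAt_LFunction_eq_zero (.inl hρ1) (hother ψ hψ))
        (fun h => absurd (Finset.mem_univ χ) h),
        (analyticAt_LFunction χ (.inr hχ1)).meromorphicOrderAt_eq, hsimple]
      rfl
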